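/- **Model.** A Liu & Layland (LL) task $\tau_k=\langle C_k,D_k,T_k\rangle$ ($C_k>0$, $0<D_k\le T_k$) releases a sequence of sequential jobs, two consecutive releases being at least $T_k$ apart; each job requires at most $C_k$ units of execution and has to be completed within $D_k$ time units of its release. Tasks $\tau_1,\dots,\tau_n$, in decreasing order of priority, run on $m\ge 1$ identical unit-speed cores under a fully preemptive global fixed-priority (GFP) scheduler: a released, uncompleted job waits only while all $m$ cores execute jobs of higher priority (jobs of the same task are served in order of release), and no job executes on two cores at once. The task set is *feasible* if every job meets its deadline in every such run. $R_k$ is the worst-case response time of $\tau_k$, i.e. the supremum of (completion time $-$ release time) over all jobs of $\tau_k$ in all runs. The *interference* on $\tau_i$ in a window is the total length of time in the window during which a job of $\tau_i$ is ready but does not execute because all $m$ cores execute jobs of higher-priority tasks. For real $\Delta\ge 0$ put $$W^{\mathrm{NC}}(\tau_j,\Delta)=\Big\lfloor \tfrac{\Delta}{T_j}\Big\rfloor C_j+\min(\Delta \bmod T_j,\;C_j),$$ $$W^{\mathrm{CI}}(\tau_j,\Delta)=\Big\lfloor \tfrac{[\Delta-C_j]_0}{T_j}\Big\rfloor C_j+C_j+\min\Big(\big[([\Delta-C_j]_0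 \bmod T_j)-(T_j-R_j)\big]_0,\;C_j\Big),\qquad [x]_0=\max(x,0),$$ and $W^{\mathrm{diff}}(\tau_j,\Delta)=W^{\mathrm{CI}}(\tau_j,\Delta)-W^{\mathrm{NC}}(\tau_j,\Delta)$. Let $\max^{l}_{j<i}$ denote the $l$-th greatest value over $j\in\{1,\dots,i-1\}$, counted with multiplicity (and $0$ if $l>i-1$). **Theorem.** Let $\{\tau_1,\dots,\tau_n\}$ be an LL task set that is feasible under GFP on $m$ identical cores. In every run, for every task $\tau_i$, the interference on $\tau_i$ in any window of length $\Delta$ is at most $$\frac1m\sum_{l=1}^{m-1}\max_{j<i}{}^{\!l}\;W^{\mathrm{diff}}(\tau_j,\Delta)+\sum_{j<i}W^{\mathrm{NC}}(\tau_j,\Delta),$$ and in fact at most $$\frac1m\Big(\sum_{l=1}^{m-1}\max_{j<i}{}^{\!l}\;W^{\mathrm{diff}}(\tau_j,\Delta)+\sum_{j<i}W^{\mathrm{NC}}(\tau_j,\Delta)\Big).$$ -/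

import Mathlib

open MeasureTheory

namespace GlobalFixedPriority

/-- A Liu & Layland (sporadic, sequential, constrained-deadline) task: worst-case execution time
`C`, relative deadline `D`, minimum inter-arrival time `T`, with `D ≤ T`. -/
structure LLTask where
  C : ℝ
  D : ℝ
  T : ℝ
  C_pos : 0 < C
  D_pos : 0 < D
  D_le_T : D ≤ T

/-- A run of `n` sporadic tasks on `m` cores. The `q`-th job of task `k` is `(k, q)`; it has a
release time and an actual execution requirement (a requirement `0` is a job that is complete as
soon as it is released, so finite job sequences are included). `core c t` is the job that core `c`
executes at time `t`, with `none` for an idle core. -/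
structure Run (n m : ℕ) where
  release : Fin n → ℕ → ℝ
  cost : Fin n → ℕ → ℝ
  core : Fin m → ℝ → Option (Fin n × ℕ)

namespace Run

variable {n m : ℕ}

/-- Job `(k, q)` executes on some core at time `t`. -/
def Executing (S : Run n m) (k : Fin n) (q : ℕ) (t : ℝ) : Prop :=
  ∃ c : Fin m, S.core c t = some (k, q)

/-- The amount of execution that job `(k, q)` has received from its release up to time `t`. -/
noncomputable def service (S : Run n m) (k : Fin n) (q : ℕ) (t : ℝ) : ℝ :=
  volume.real {s : ℝ | S.release k q ≤ s ∧ s < t ∧ S.Executing k q s}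

/-- Job `(k, q)` has received its whole execution requirement by time `t`. -/
def CompletedBy (S : Run n m) (k : Fin n) (q : ℕ) (t : ℝ) : Prop :=
  S.cost k q ≤ S.service k q t

/-- Job `(k, q)` is ready (released and not completed) at time `t`. -/
def Ready (S : Run n m) (k : Fin n) (q : ℕ) (t : ℝ) : Prop :=
  S.release k q ≤ t ∧ ¬ S.CompletedBy k q t

/-- `S` is a run of the task set `τ` that a fully preemptive global fixed-priority scheduler on
`m` unit-speed identical cores produces; a smaller task index means a higher priority, and jobs of
one task are served in order of release. -/
structure IsGFP (τ : Fin n → LLTask) (S : Run n m) : Prop where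
  separation : ∀ k q, S.release k q + (τ k).T ≤ S.release k (q + 1)
  cost_nonneg : ∀ k q, 0 ≤ S.cost k q
  cost_le : ∀ k q, S.cost k q ≤ (τ k).C
  measurable : ∀ c j, MeasurableSet {t : ℝ | S.core c t = some j}
  /-- no job executes on two cores at the same time -/
  sequential : ∀ c c' t j, S.core c t = some j → S.core c' t = some j → c = c'
  /-- only ready jobs execute -/
  ready_of_core : ∀ c t k q, S.core c t = some (k, q) → S.Ready k q t
  /-- a ready job waits only while every core executes a job of higher priority -/
  priority : ∀ k q t, S.Ready k q t → ¬ S.Executing k q t →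
    ∀ c, ∃ k' q', S.core c t = some (k', q') ∧ (k' < k ∨ (k' = k ∧ q' < q))

/-- `ρ` is the response time of job `(k, q)`: the time from its release to its completion. -/
def IsResponseTime (S : Run n m) (k : Fin n) (q : ℕ) (ρ : ℝ) : Prop :=
  IsLeast {x : ℝ | 0 ≤ x ∧ S.CompletedBy k q (S.release k q + x)} ρ

/-- The interference on task `i` in the window `[a, a + Δ)`: the total length of time in the window
during which some job of task `i` is ready but does not execute, because all cores execute jobs of
tasks of higher priority than `i`. -/
noncomputable def interference (S : Run n m) (i : Fin n) (a Δ : ℝ) : ℝ :=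
  volume.real {t : ℝ | t ∈ Set.Ico a (a + Δ) ∧
    (∃ q, S.Ready i q t ∧ ¬ S.Executing i q t) ∧
    ∀ c : Fin m, ∃ h q, h < i ∧ S.core c t = some (h, q)}

end Run

/-- The task set is feasible under global fixed priority on `m` cores: in every run, every job is
completed by its deadline. -/
def Feasible {n : ℕ} (m : ℕ) (τ : Fin n → LLTask) : Prop :=
  ∀ S : Run n m, S.IsGFP τ → ∀ k q, S.CompletedBy k q (S.release k q + (τ k).D)

/-- The worst-case response time of task `k`: the supremum of the response times of all jobs of
`k` in all runs. -/
noncomputable def wcrt {n : ℕ} (m : ℕ) (τ : Fin n → LLTask) (k : Fin n) : ℝ :=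
  sSup {ρ : ℝ | ∃ S : Run n m, S.IsGFP τ ∧ ∃ q, S.IsResponseTime k q ρ}

/-- `x mod T` for real numbers. -/
noncomputable def realMod (x T : ℝ) : ℝ := x - (⌊x / T⌋ : ℝ) * T

/-- Workload bound of a task without carry-in in a window of length `Δ`. -/
noncomputable def WNC (C T Δ : ℝ) : ℝ :=
  (⌊Δ / T⌋ : ℝ) * C + min (realMod Δ T) C

/-- Workload bound of a task with carry-in and worst-case response time `R` in a window of
length `Δ`. -/
noncomputable def WCI (C T R Δ : ℝ) : ℝ :=
  (⌊max (Δ - C) 0 / T⌋ : ℝ) * C + C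
    + min (max (realMod (max (Δ - C) 0) T - (T - R)) 0) C

/-- Carry-in excess. -/
noncomputable def Wdiff (C T R Δ : ℝ) : ℝ := WCI C T R Δ - WNC C T Δ

/-- The `l`-th greatest value (`l = 1, 2, …`) of `f` on `s`, counted with multiplicity; it is `0` if
`s` has fewer than `l` elements. -/
noncomputable def nthGreatest {ι : Type*} (s : Finset ι) (f : ι → ℝ) (l : ℕ) : ℝ :=
  ((s.val.map f).sort (· ≥ ·)).getD (l - 1) 0

/-- The sum of the `m - 1` greatest carry-in excesses among the tasks of higher priority than
`i`. -/
noncomputable def carryInTerm {n : ℕ} (m : ℕ) (τ : Fin n → LLTask) (i : Fin n) (Δ : ℝ) : ℝ :=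
  ∑ l ∈ Finset.Icc 1 (m - 1),
    nthGreatest (Finset.Iio i) (fun j => Wdiff (τ j).C (τ j).T (wcrt m τ j) Δ) l

/-- The sum of the no-carry-in workload bounds of the tasks of higher priority than `i`. -/
noncomputable def noCarryInTerm {n : ℕ} (τ : Fin n → LLTask) (i : Fin n) (Δ : ℝ) : ℝ :=
  ∑ j ∈ Finset.Iio i, WNC (τ j).C (τ j).T Δ

end GlobalFixedPriority

/-! Call a time busy if every core executes a task of higher priority than `i`; interference accrues
only at busy times. Move the window left to the supremum `b` of the non-busy times up to `a`. The
gap is busy, so no busy time is lost (`volume_inter_Ico_le_shift`).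

At non-busy times arbitrarily close to `b` from the left, or at `b` itself, every ready
higher-priority task executes, on a core of its own, and some core is left over. Hence at most `m -
1` tasks carry work into the new window (`card_carryIn_lt`). Each busy instant consumes `m` units of
higher-priority execution, so `m` times the interference is at most the total workload there.

A task's workload is at most `WCI` with carry-in and `WNC` without. Both are compared with
`staircase`, the work of periodic jobs executing from release on. Since `Wdiff` is nonnegative, the
excess of the carry-in tasks is at most the sum of the `m - 1` greatest values. -/

namespace GlobalFixedPriority

/-! ### The staircase function -/

/-- Work available before time `y` from jobs of size `C` released at `0, T, …, (N - 1) T`, each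
executing from its release on. -/
noncomputable def staircase (C T : ℝ) (N : ℕ) (y : ℝ) : ℝ :=
  ∑ p ∈ Finset.range N, min C (max (y - p * T) 0)

theorem staircase_succ (C T : ℝ) (N : ℕ) (y : ℝ) :
    staircase C T (N + 1) y = min C (max y 0) + staircase C T N (y - T) := by
  unfold staircase
  rw [Finset.sum_range_succ', add_comm]
  congr 1
  · simp
  · refine Finset.sum_congr rfl fun p _ => ?_
    push_cast
    ring_nf

theorem staircase_mono {C T : ℝ} (N : ℕ) : Monotone (staircase C T N) := by
  intro x y hxy
  unfold staircase
  gcongr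

theorem staircase_of_nonpos {C T : ℝ} (hC : 0 ≤ C) (hT : 0 ≤ T) (N : ℕ) {y : ℝ} (hy : y ≤ 0) :
    staircase C T N y = 0 := by
  refine Finset.sum_eq_zero fun p _ => ?_
  have : 0 ≤ p * T := by positivity
  rw [max_eq_right (by linarith), min_eq_right hC]

theorem staircase_nonneg {C T : ℝ} (hC : 0 ≤ C) (N : ℕ) (y : ℝ) : 0 ≤ staircase C T N y :=
  Finset.sum_nonneg fun _ _ => le_min hC (le_max_right _ _)

/-- As `C ≤ T`, the steps rise over intervals that do not overlap, so the slope never exceeds one.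
-/
theorem staircase_add_le {C T : ℝ} (hC : 0 ≤ C) (hCT : C ≤ T) (N : ℕ) {y δ : ℝ} (hδ : 0 ≤ δ) :
    staircase C T N (y + δ) ≤ staircase C T N y + δ := by
  induction N generalizing y δ with
  | zero => simpa [staircase] using hδ
  | succ N ih =>
    rw [staircase_succ, staircase_succ]
    have h0 := staircase_nonneg (T := T) hC N (y - T)
    rcases lt_or_ge (y + δ) T with h | h
    · rw [staircase_of_nonpos hC (hC.trans hCT) N (by linarith : y + δ - T ≤ 0)]
      have : min C (max (y + δ) 0) ≤ min C (max y 0) + δ := by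
        rw [← min_add_add_right, ← max_add_add_right]
        exact min_le_min (by linarith) (max_le_max le_rfl (by linarith))
      linarith
    · rcases lt_or_ge y C with hy | hy
      · have := ih (y := 0) (δ := y + δ - T) (by linarith)
        rw [zero_add, staircase_of_nonpos hC (hC.trans hCT) N le_rfl] at this
        have h1 : min C (max (y + δ) 0) ≤ C := min_le_left _ _
        have h2 : y ≤ min C (max y 0) := le_min hy.le (le_max_left _ _)
        linarith
      · have := ih (y := y - T) hδ
        have h1 : min C (max (y + δ) 0) ≤ C := min_le_left _ _
        have h2 : C ≤ min C (max y 0) := le_min le_rfl (hy.trans (le_max_left _ _))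
        rw [show y + δ - T = y - T + δ by ring]
        linarith

/-! ### Comparison of the staircase with `WNC` and `WCI`, by peeling off one period at a time. -/

theorem floor_sub_period {T : ℝ} (hT : 0 < T) (y : ℝ) : ⌊(y - T) / T⌋ = ⌊y / T⌋ - 1 := by
  rw [sub_div, div_self hT.ne', Int.floor_sub_one]

theorem floor_of_lt_period {T y : ℝ} (hy : 0 ≤ y) (hyT : y < T) : ⌊y / T⌋ = 0 := by
  rw [Int.floor_eq_zero_iff]
  exact ⟨div_nonneg hy (hy.trans hyT.le), (div_lt_one (hy.trans_lt hyT)).2 hyT⟩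

theorem realMod_sub_period {T : ℝ} (hT : 0 < T) (y : ℝ) : realMod (y - T) T = realMod y T := by
  unfold realMod
  rw [floor_sub_period hT]
  push_cast
  ring

theorem realMod_of_lt_period {T y : ℝ} (hy : 0 ≤ y) (hyT : y < T) : realMod y T = y := by
  simp [realMod, floor_of_lt_period hy hyT]

theorem WNC_eq_add_sub_period (C : ℝ) {T : ℝ} (hT : 0 < T) (y : ℝ) :
    WNC C T y = C + WNC C T (y - T) := by
  unfold WNC
  rw [floor_sub_period hT, realMod_sub_period hT]
  push_cast
  ring

theorem WNC_of_lt_period (C : ℝ) {T y : ℝ} (hy : 0 ≤ y) (hyT : y < T) :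
    WNC C T y = min y C := by
  simp [WNC, floor_of_lt_period hy hyT, realMod_of_lt_period hy hyT]

theorem WNC_nonneg {C T y : ℝ} (hC : 0 ≤ C) (hT : 0 < T) (hy : 0 ≤ y) : 0 ≤ WNC C T y := by
  have h1 : (0 : ℝ) ≤ ⌊y / T⌋ := by exact_mod_cast Int.floor_nonneg.2 (div_nonneg hy hT.le)
  have h2 : 0 ≤ realMod y T := by
    have := Int.floor_le (y / T)
    rw [le_div_iff₀ hT] at this
    unfold realMod
    linarith
  exact add_nonneg (mul_nonneg h1 hC) (le_min h2 hC)

theorem staircase_le_WNC {C T : ℝ} (hC : 0 ≤ C) (hT : 0 < T) (N : ℕ) {y : ℝ}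
    (hy : 0 ≤ y) : staircase C T N y ≤ WNC C T y := by
  induction N generalizing y with
  | zero => simpa [staircase] using WNC_nonneg hC hT hy
  | succ N ih =>
    rw [staircase_succ]
    rcases lt_or_ge y T with h | h
    · rw [staircase_of_nonpos hC hT.le N (by linarith : y - T ≤ 0), WNC_of_lt_period C hy h,
        max_eq_left hy, min_comm, add_zero]
    · rw [WNC_eq_add_sub_period C hT]
      exact add_le_add (min_le_left _ _) (ih (by linarith))

theorem WNC_le_staircase {C T : ℝ} (hC : 0 ≤ C) (hT : 0 < T) (hCT : C ≤ T) (N : ℕ) {y : ℝ}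
    (hy : 0 ≤ y) (hN : y < N * T) : WNC C T y ≤ staircase C T N y := by
  induction N generalizing y with
  | zero => simp at hN; linarith
  | succ N ih =>
    rw [staircase_succ]
    rcases lt_or_ge y T with h | h
    · rw [WNC_of_lt_period C hy h, max_eq_left hy, min_comm]
      exact le_add_of_nonneg_right (staircase_nonneg hC _ _)
    · rw [WNC_eq_add_sub_period C hT]
      push_cast at hN
      refine add_le_add (le_min le_rfl ((hCT.trans h).trans (le_max_left _ _))) (ih ?_ ?_) <;>
        linarith

theorem staircase_le_carryIn {C T R : ℝ} (hC : 0 ≤ C) (hT : 0 < T) (hRT : R ≤ T)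
    (N : ℕ) {x : ℝ} (hx : 0 ≤ x) :
    staircase C T N (x + R - T)
      ≤ (⌊x / T⌋ : ℝ) * C + min (max (realMod x T - (T - R)) 0) C := by
  induction N generalizing x with
  | zero =>
    have h1 : (0 : ℝ) ≤ ⌊x / T⌋ := by exact_mod_cast Int.floor_nonneg.2 (div_nonneg hx hT.le)
    simpa [staircase] using add_nonneg (mul_nonneg h1 hC) (le_min (le_max_right _ _) hC)
  | succ N ih =>
    rw [staircase_succ]
    rcases lt_or_ge x T with h | h
    · rw [staircase_of_nonpos hC hT.le N (by linarith), floor_of_lt_period hx h,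
        realMod_of_lt_period hx h, min_comm, show x - (T - R) = x + R - T by ring]
      simp
    · have := ih (x := x - T) (by linarith)
      rw [floor_sub_period hT, realMod_sub_period hT,
        show x - T + R - T = x + R - T - T by ring] at this
      push_cast at this
      have h1 : min C (max (x + R - T) 0) ≤ C := min_le_left _ _
      linarith

theorem add_staircase_le_WCI {C T R Δ : ℝ} (hC : 0 ≤ C) (hT : 0 < T) (hRT : R ≤ T) (N : ℕ) :
    C + staircase C T N (Δ - C + R - T) ≤ WCI C T R Δ := by
  have h1 := staircase_le_carryIn hC hT hRT N (le_max_right (Δ - C) 0)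
  have h2 : staircase C T N (Δ - C + R - T) ≤ staircase C T N (max (Δ - C) 0 + R - T) :=
    staircase_mono N (by gcongr; exact le_max_left _ _)
  unfold WCI
  linarith

/-- Here `α` is the time from the window start to the latest completion of the carry-in job. The
worst case is `α = C`: raising a smaller `α` gains in the first term at least what the staircase, of
slope at most one, loses; lowering a larger one costs nothing. -/
theorem carryIn_add_staircase_le_WCI {C T R Δ α : ℝ} (hC : 0 ≤ C) (hT : 0 < T) (hCT : C ≤ T)
    (hRT : R ≤ T) (N : ℕ) :
    min C α + staircase C T N (Δ - α + R - T) ≤ WCI C T R Δ := by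
  refine le_trans ?_ (add_staircase_le_WCI hC hT hRT N)
  rcases le_total α C with h | h
  · have := staircase_add_le hC hCT N (y := Δ - C + R - T) (sub_nonneg.2 h)
    rw [show Δ - C + R - T + (C - α) = Δ - α + R - T by ring] at this
    rw [min_eq_right h]
    linarith
  · rw [min_eq_left h]
    gcongr
    exact staircase_mono N (by linarith)

/-- Behind a first job of size at most `C`, the remaining staircase is evaluated at `Δ - T` without
carry-in and at `Δ - C + R - T` with it; the latter is larger because `C ≤ R`. -/
theorem Wdiff_nonneg {C T R Δ : ℝ} (hC : 0 ≤ C) (hT : 0 < T) (hCT : C ≤ T) (hCR : C ≤ R)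
    (hRT : R ≤ T) (hΔ : 0 ≤ Δ) : 0 ≤ Wdiff C T R Δ := by
  obtain ⟨N, hN⟩ := exists_nat_gt (Δ / T)
  rw [div_lt_iff₀ hT] at hN
  have h1 : WNC C T Δ ≤ staircase C T (N + 1) Δ :=
    WNC_le_staircase hC hT hCT _ hΔ (by push_cast; linarith)
  rw [staircase_succ] at h1
  have h2 : staircase C T N (Δ - T) ≤ staircase C T N (Δ - C + R - T) :=
    staircase_mono N (by linarith)
  have h3 := add_staircase_le_WCI (Δ := Δ) hC hT hRT N
  have h4 : min C (max Δ 0) ≤ C := min_le_left _ _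
  unfold Wdiff
  linarith

/-! ### The sum of the greatest values -/

/-- Exchange argument: pair the head of `L` with itself if it lies in `M`, otherwise with any
element of `M`, which is no larger. Nonnegativity covers an `M` with fewer than `k` elements. -/
theorem multiset_sum_le_take_sum (L : List ℝ) (hL : L.Pairwise (· ≥ ·)) (h0 : ∀ x ∈ L, 0 ≤ x)
    (k : ℕ) (M : Multiset ℝ) (hM : M ≤ (L : Multiset ℝ)) (hk : M.card ≤ k) :
    M.sum ≤ (L.take k).sum := by
  induction L generalizing k M with
  | nil =>
    have : M = 0 := by simpa using hM
    simp [this]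
  | cons x L ih =>
    cases k with
    | zero => simp_all
    | succ k =>
      rw [List.pairwise_cons] at hL
      have ih' := ih hL.2 fun y hy => h0 y (List.mem_cons_of_mem _ hy)
      rw [List.take_succ_cons, List.sum_cons]
      rw [← Multiset.cons_coe] at hM
      by_cases hx : x ∈ M
      · obtain ⟨M', rfl⟩ := Multiset.exists_cons_of_mem hx
        rw [Multiset.sum_cons]
        gcongr
        refine ih' k M' ((Multiset.cons_le_cons_iff x).1 hM) ?_
        simpa using hk
      · have hML : M ≤ (L : Multiset ℝ) := (Multiset.le_cons_of_notMem hx).1 hM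
        rcases M.empty_or_exists_mem with rfl | ⟨y, hy⟩
        · rw [Multiset.sum_zero]
          refine add_nonneg (h0 x List.mem_cons_self) (List.sum_nonneg fun z hz => ?_)
          exact h0 z (List.mem_cons_of_mem _ (List.mem_of_mem_take hz))
        · obtain ⟨M', rfl⟩ := Multiset.exists_cons_of_mem hy
          rw [Multiset.sum_cons]
          refine add_le_add (hL.1 y ?_) (ih' k M' ((Multiset.le_cons_self _ _).trans hML) ?_)
          · simpa using Multiset.mem_of_le hML hy
          · simpa using hk

theorem list_sum_take_eq_sum_getD (L : List ℝ) (k : ℕ) :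
    (L.take k).sum = ∑ l ∈ Finset.Icc 1 k, L.getD (l - 1) 0 := by
  induction k with
  | zero => simp
  | succ k ih =>
    rw [Finset.sum_Icc_succ_top (by omega), ← ih, Nat.add_sub_cancel]
    rcases lt_or_ge k L.length with h | h
    · rw [List.sum_take_succ L k h, List.getD_eq_getElem _ _ h]
    · rw [List.take_of_length_le h, List.take_of_length_le (by omega),
        List.getD_eq_default _ _ h, add_zero]

theorem sum_le_sum_nthGreatest {ι : Type*} {s A : Finset ι} {f : ι → ℝ} (hA : A ⊆ s)
    (hf : ∀ j ∈ s, 0 ≤ f j) {k : ℕ} (hk : A.card ≤ k) :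
    ∑ j ∈ A, f j ≤ ∑ l ∈ Finset.Icc 1 k, nthGreatest s f l := by
  unfold nthGreatest
  rw [← list_sum_take_eq_sum_getD]
  refine multiset_sum_le_take_sum _ (Multiset.pairwise_sort _ _) ?_ k (A.val.map f) ?_ (by simpa)
  · intro x hx
    rw [Multiset.mem_sort, Multiset.mem_map] at hx
    obtain ⟨j, hj, rfl⟩ := hx
    exact hf j hj
  · rw [Multiset.sort_eq]
    exact Multiset.map_le_map (Finset.val_le_iff.2 hA)


theorem volume_ne_top_of_subset_Ico {A : Set ℝ} {x y : ℝ} (h : ∀ t ∈ A, x ≤ t ∧ t < y) :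
    volume A ≠ ⊤ :=
  ((measure_mono fun t ht => h t ht).trans_lt (measure_Ico_lt_top (a := x) (b := y))).ne

namespace Run

variable {n m : ℕ} {τ : Fin n → LLTask} {S : Run n m}

/-! ### Executions and service -/

theorem Executing.ready (hS : S.IsGFP τ) {k : Fin n} {q : ℕ} {t : ℝ} (h : S.Executing k q t) :
    S.Ready k q t := by
  obtain ⟨c, hc⟩ := h
  exact hS.ready_of_core c t k q hc

theorem service_mono (S : Run n m) (k : Fin n) (q : ℕ) : Monotone (S.service k q) := by
  intro t u htu
  refine measureReal_mono (fun s hs => ⟨hs.1, hs.2.1.trans_le htu, hs.2.2⟩) ?_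
  exact volume_ne_top_of_subset_Ico fun s hs => ⟨hs.1, hs.2.1⟩

theorem service_le_add (S : Run n m) (k : Fin n) (q : ℕ) {t u : ℝ} (htu : t ≤ u) :
    S.service k q u ≤ S.service k q t + (u - t) := by
  have hsub : {s : ℝ | S.release k q ≤ s ∧ s < u ∧ S.Executing k q s}
      ⊆ {s : ℝ | S.release k q ≤ s ∧ s < t ∧ S.Executing k q s} ∪ Set.Ico t u := by
    intro s hs
    rcases lt_or_ge s t with h | h
    · exact Or.inl ⟨hs.1, h, hs.2.2⟩
    · exact Or.inr ⟨h, hs.2.1⟩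
  have hfin : volume {s : ℝ | S.release k q ≤ s ∧ s < t ∧ S.Executing k q s} ≠ ⊤ :=
    volume_ne_top_of_subset_Ico fun s hs => ⟨hs.1, hs.2.1⟩
  refine (measureReal_mono hsub ?_).trans ((measureReal_union_le _ _).trans ?_)
  · exact (measure_union_lt_top hfin.lt_top measure_Ico_lt_top).ne
  · rw [Real.volume_real_Ico_of_le htu]
    rfl

theorem continuous_service (S : Run n m) (k : Fin n) (q : ℕ) : Continuous (S.service k q) := by
  have : LipschitzWith 1 (S.service k q) := by
    refine LipschitzWith.of_le_add_mul 1 fun x y => ?_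
    rw [NNReal.coe_one, one_mul, Real.dist_eq]
    rcases le_total x y with h | h
    · exact (S.service_mono k q h).trans (le_add_of_nonneg_right (abs_nonneg _))
    · exact (S.service_le_add k q h).trans (by gcongr; exact le_abs_self _)
  exact this.continuous

theorem CompletedBy.mono {k : Fin n} {q : ℕ} {t u : ℝ} (h : S.CompletedBy k q t) (htu : t ≤ u) :
    S.CompletedBy k q u :=
  le_trans h (S.service_mono k q htu)

theorem release_add_mul_le (hS : S.IsGFP τ) (k : Fin n) (q p : ℕ) :
    S.release k q + p * (τ k).T ≤ S.release k (q + p) := by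
  induction p with
  | zero => simp
  | succ p ih =>
    have := hS.separation k (q + p)
    push_cast
    rw [← add_assoc]
    linarith

theorem release_mono (hS : S.IsGFP τ) (k : Fin n) : Monotone (S.release k) :=
  monotone_nat_of_le_succ fun q => by
    have := hS.separation k q
    have := (τ k).D_pos
    have := (τ k).D_le_T
    linarith

end Run

theorem LLTask.T_pos (x : LLTask) : 0 < x.T := x.D_pos.trans_le x.D_le_T

variable {n m : ℕ} {τ : Fin n → LLTask}

/-! ### Worst-case response times -/

/-- Without an upper bound the `sSup` in `wcrt` would be the default value `0`. -/
theorem Feasible.wcrt_bddAbove (hτ : Feasible m τ) (k : Fin n) :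
    (τ k).D ∈ upperBounds
      {ρ : ℝ | ∃ S : Run n m, S.IsGFP τ ∧ ∃ q, S.IsResponseTime k q ρ} := by
  rintro ρ ⟨S, hS, q, hρ⟩
  exact hρ.2 ⟨(τ k).D_pos.le, hτ S hS k q⟩

theorem Feasible.completedBy_wcrt (hτ : Feasible m τ) {S : Run n m} (hS : S.IsGFP τ)
    (k : Fin n) (q : ℕ) : S.CompletedBy k q (S.release k q + wcrt m τ k) := by
  set A := {x : ℝ | 0 ≤ x ∧ S.CompletedBy k q (S.release k q + x)} with hA
  have hcont := S.continuous_service k q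
  -- Continuity of the service makes the infimum of the completion delays a genuine response time,
  -- which `wcrt` then dominates.
  have hclosed : IsClosed A := by
    refine (isClosed_Ici (a := (0 : ℝ))).inter ?_
    exact isClosed_le continuous_const (hcont.comp (continuous_const.add continuous_id))
  have hne : A.Nonempty := ⟨(τ k).D, (τ k).D_pos.le, hτ S hS k q⟩
  have hbdd : BddBelow A := ⟨0, fun x hx => hx.1⟩
  have hleast : S.IsResponseTime k q (sInf A) :=
    ⟨hclosed.csInf_mem hne hbdd, fun x hx => csInf_le hbdd hx⟩
  have hle : sInf A ≤ wcrt m τ k := le_csSup ⟨_, hτ.wcrt_bddAbove k⟩ ⟨S, hS, q, hleast⟩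
  exact hleast.1.2.mono (by linarith)

/-- The run in which the first job of task `k` executes alone from time `0` on. -/
noncomputable def soloRun (m : ℕ) [NeZero m] (τ : Fin n → LLTask) (k : Fin n) : Run n m where
  release j q := q * (τ j).T
  cost j q := if j = k ∧ q = 0 then (τ k).C else 0
  core c t := if c = 0 ∧ 0 ≤ t ∧ t < (τ k).C then some (k, 0) else none

theorem soloRun_executing_iff [NeZero m] {k j : Fin n} {q : ℕ} {t : ℝ} :
    (soloRun m τ k).Executing j q t ↔ (j = k ∧ q = 0) ∧ 0 ≤ t ∧ t < (τ k).C := by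
  simp only [Run.Executing, soloRun]
  constructor
  · rintro ⟨c, hc⟩
    split_ifs at hc with h
    simp only [Option.some.injEq, Prod.mk.injEq] at hc
    exact ⟨⟨hc.1.symm, hc.2.symm⟩, h.2⟩
  · rintro ⟨⟨rfl, rfl⟩, h⟩
    exact ⟨0, by rw [if_pos ⟨rfl, h⟩]⟩

theorem soloRun_service [NeZero m] {k : Fin n} {t : ℝ} (ht : 0 ≤ t) :
    (soloRun m τ k).service k 0 t = min t (τ k).C := by
  have : {s : ℝ | (soloRun m τ k).release k 0 ≤ s ∧ s < t ∧ (soloRun m τ k).Executing k 0 s}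
      = Set.Ico 0 (min t (τ k).C) := by
    ext s
    simp only [soloRun_executing_iff, Set.mem_ofPred_eq, Set.mem_Ico, lt_min_iff]
    simp only [soloRun, Nat.cast_zero, zero_mul]
    tauto
  rw [Run.service, this, Real.volume_real_Ico_of_le (le_min ht (τ k).C_pos.le), sub_zero]

theorem soloRun_completedBy_iff [NeZero m] {k : Fin n} {t : ℝ} (ht : 0 ≤ t) :
    (soloRun m τ k).CompletedBy k 0 t ↔ (τ k).C ≤ t := by
  rw [Run.CompletedBy, soloRun_service ht]
  simp [soloRun]

theorem soloRun_isGFP [NeZero m] (k : Fin n) : (soloRun m τ k).IsGFP τ where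
  separation j q := by
    simp only [soloRun]
    push_cast
    linarith
  cost_nonneg j q := by
    simp only [soloRun]
    split_ifs
    exacts [(τ k).C_pos.le, le_rfl]
  cost_le j q := by
    simp only [soloRun]
    split_ifs with h
    · rw [h.1]
    · exact (τ j).C_pos.le
  measurable c j := by
    have : {t : ℝ | (soloRun m τ k).core c t = some j}
        = {t : ℝ | c = 0 ∧ j = (k, 0) ∧ t ∈ Set.Ico 0 (τ k).C} := by
      ext t
      simp only [soloRun, Set.mem_ofPred_eq, Set.mem_Ico]
      split_ifs with h
      · simp only [Option.some.injEq]
        exact ⟨fun e => ⟨h.1, e.symm, h.2⟩, fun e => e.2.1.symm⟩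
      · simp only [false_iff]
        exact fun e => h ⟨e.1, e.2.2⟩
    rw [this]
    by_cases h : c = 0 ∧ j = (k, 0)
    · convert measurableSet_Ico (a := (0 : ℝ)) (b := (τ k).C) using 1
      ext t
      simp only [h.1, h.2, true_and, Set.mem_ofPred_eq]
    · convert MeasurableSet.empty
      ext t
      simp only [Set.mem_ofPred_eq, Set.mem_empty_iff_false, iff_false]
      tauto
  sequential c c' t j hc hc' := by
    simp only [soloRun] at hc hc'
    split_ifs at hc hc' with h h'
    rw [h.1, h'.1]
  ready_of_core c t j q hc := by
    have hE : (soloRun m τ k).Executing j q t := ⟨c, hc⟩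
    obtain ⟨⟨rfl, rfl⟩, h⟩ := soloRun_executing_iff.1 hE
    refine ⟨by simpa [soloRun] using h.1, ?_⟩
    rw [soloRun_completedBy_iff h.1]
    exact h.2.not_ge
  priority j q t hR hE := by
    exfalso
    by_cases hj : j = k ∧ q = 0
    · obtain ⟨rfl, rfl⟩ := hj
      have h0 : 0 ≤ t := by simpa [soloRun] using hR.1
      have h1 := hR.2
      rw [soloRun_completedBy_iff h0, not_le] at h1
      exact hE (soloRun_executing_iff.2 ⟨⟨rfl, rfl⟩, h0, h1⟩)
    · refine hR.2 ?_
      rw [Run.CompletedBy]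
      refine le_trans (le_of_eq ?_) measureReal_nonneg
      simp [soloRun, hj]

/-- The first job of `soloRun` has response time exactly `C`. With `wcrt_le_T` this also yields `C ≤
T`, which `LLTask` does not assume. -/
theorem Feasible.C_le_wcrt (hτ : Feasible m τ) (hm : 0 < m) (k : Fin n) :
    (τ k).C ≤ wcrt m τ k := by
  have : NeZero m := ⟨hm.ne'⟩
  refine le_csSup ⟨_, hτ.wcrt_bddAbove k⟩ ⟨soloRun m τ k, soloRun_isGFP k, 0, ?_⟩
  have hr : (soloRun m τ k).release k 0 = 0 := by simp [soloRun]
  constructor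
  · refine ⟨(τ k).C_pos.le, ?_⟩
    rw [hr, zero_add, soloRun_completedBy_iff (τ k).C_pos.le]
  · rintro x ⟨hx, hc⟩
    rwa [hr, zero_add, soloRun_completedBy_iff hx] at hc

theorem Feasible.wcrt_le_T (hτ : Feasible m τ) (k : Fin n) :
    wcrt m τ k ≤ (τ k).T := by
  exact (Real.sSup_le (hτ.wcrt_bddAbove k) (τ k).D_pos.le).trans (τ k).D_le_T

theorem Feasible.C_le_T (hτ : Feasible m τ) (hm : 0 < m) (k : Fin n) :
    (τ k).C ≤ (τ k).T :=
  (hτ.C_le_wcrt hm k).trans (hτ.wcrt_le_T k)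

/-! ### Execution of a single job in a window -/

namespace Run

variable {S : Run n m}

/-- The amount of execution of job `(k, q)` in the window `[b, b + Δ)`. -/
noncomputable def work (S : Run n m) (b Δ : ℝ) (k : Fin n) (q : ℕ) : ℝ :=
  volume.real {t : ℝ | t ∈ Set.Ico b (b + Δ) ∧ S.Executing k q t}

theorem work_nonneg (S : Run n m) (b Δ : ℝ) (k : Fin n) (q : ℕ) : 0 ≤ S.work b Δ k q :=
  measureReal_nonneg

theorem lt_release_add_wcrt_of_executing (hτ : Feasible m τ) (hS : S.IsGFP τ) {k : Fin n} {q : ℕ}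
    {t : ℝ} (h : S.Executing k q t) : t < S.release k q + wcrt m τ k := by
  by_contra! hle
  exact (h.ready hS).2 ((hτ.completedBy_wcrt hS k q).mono hle)

/-- At an execution time `t` within `ε` of the last one the job is still incomplete, so it has
received less than its cost; less than `ε` can follow. -/
theorem volume_executing_le_C (hτ : Feasible m τ) (hS : S.IsGFP τ) (k : Fin n) (q : ℕ) :
    volume.real {t : ℝ | S.Executing k q t} ≤ (τ k).C := by
  set E := {t : ℝ | S.Executing k q t} with hE
  rcases E.eq_empty_or_nonempty with h | hne
  · rw [h, measureReal_empty]
    exact (τ k).C_pos.le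
  have hbdd : BddAbove E := ⟨_, fun t ht => (lt_release_add_wcrt_of_executing hτ hS ht).le⟩
  refine le_of_forall_pos_le_add fun ε hε => ?_
  obtain ⟨t, ht, htε⟩ := exists_lt_of_lt_csSup hne (sub_lt_self (sSup E) hε)
  have hsub : E ⊆ {s : ℝ | S.release k q ≤ s ∧ s < t ∧ S.Executing k q s}
      ∪ Set.Icc t (sSup E) := by
    intro s hs
    rcases lt_or_ge s t with h | h
    · exact Or.inl ⟨(Executing.ready hS hs).1, h, hs⟩
    · exact Or.inr ⟨h, le_csSup hbdd hs⟩
  have hfin : volume {s : ℝ | S.release k q ≤ s ∧ s < t ∧ S.Executing k q s} ≠ ⊤ :=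
    volume_ne_top_of_subset_Ico fun s hs => ⟨hs.1, hs.2.1⟩
  refine (measureReal_mono hsub ?_).trans ((measureReal_union_le _ _).trans ?_)
  · exact (measure_union_lt_top hfin.lt_top measure_Icc_lt_top).ne
  · rw [Real.volume_real_Icc_of_le (le_csSup hbdd ht)]
    have h1 : S.service k q t < S.cost k q := not_le.1 (Executing.ready hS ht).2
    have h2 := hS.cost_le k q
    change S.service k q t + _ ≤ _
    linarith

theorem work_le_C (hτ : Feasible m τ) (hS : S.IsGFP τ) (b Δ : ℝ) (k : Fin n) (q : ℕ) :
    S.work b Δ k q ≤ (τ k).C := by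
  refine (measureReal_mono (fun t ht => ht.2) ?_).trans (volume_executing_le_C hτ hS k q)
  refine volume_ne_top_of_subset_Ico (x := S.release k q)
    (y := S.release k q + wcrt m τ k) fun s hs => ?_
  exact ⟨(Executing.ready hS hs).1, lt_release_add_wcrt_of_executing hτ hS hs⟩

theorem work_le_of_subset_Ico {b Δ u v : ℝ} {k : Fin n} {q : ℕ}
    (h : ∀ t, b ≤ t → t < b + Δ → S.Executing k q t → u ≤ t ∧ t < v) :
    S.work b Δ k q ≤ max (v - u) 0 := by
  have := measureReal_mono (μ := volume) (s₂ := Set.Ico u v)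
    (fun t (ht : t ∈ Set.Ico b (b + Δ) ∧ S.Executing k q t) => h t ht.1.1 ht.1.2 ht.2)
    measure_Ico_lt_top.ne
  rwa [Real.volume_real_Ico] at this

theorem work_eq_zero {b Δ : ℝ} {k : Fin n} {q : ℕ}
    (h : ∀ t, b ≤ t → t < b + Δ → ¬ S.Executing k q t) : S.work b Δ k q = 0 := by
  refine le_antisymm ?_ (S.work_nonneg b Δ k q)
  have := work_le_of_subset_Ico (S := S) (u := 0) (v := 0)
    fun t h1 h2 h3 => (h t h1 h2 h3).elim
  simpa using this

theorem work_le_of_le_release (hτ : Feasible m τ) (hS : S.IsGFP τ) {b Δ r : ℝ} {k : Fin n} {q : ℕ}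
    (hr : b + r ≤ S.release k q) : S.work b Δ k q ≤ min (τ k).C (max (Δ - r) 0) := by
  refine le_min (work_le_C hτ hS b Δ k q) ?_
  have := work_le_of_subset_Ico (S := S) (b := b) (Δ := Δ) (u := b + r) (v := b + Δ) (k := k)
    (q := q) fun t _ h2 h3 => ⟨hr.trans (h3.ready hS).1, h2⟩
  rwa [add_sub_add_left_eq_sub] at this

/-! ### Workload of a task in a window -/

theorem sum_work_shift_le_staircase (hτ : Feasible m τ) (hS : S.IsGFP τ) {b Δ r : ℝ} {k : Fin n}
    {q₀ : ℕ} (hr : b + r ≤ S.release k q₀) (N : ℕ) :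
    ∑ p ∈ Finset.range N, S.work b Δ k (q₀ + p) ≤ staircase (τ k).C (τ k).T N (Δ - r) := by
  refine Finset.sum_le_sum fun p _ => ?_
  rw [sub_sub]
  exact work_le_of_le_release hτ hS (by linarith [release_add_mul_le hS k q₀ p])

/-- Task `k` has a carry-in job at time `b`. -/
def CarryIn (S : Run n m) (b : ℝ) (k : Fin n) : Prop :=
  ∃ q, S.release k q < b ∧ ¬ S.CompletedBy k q b

theorem sum_work_le_WNC (hτ : Feasible m τ) (hS : S.IsGFP τ) {b Δ : ℝ} (hΔ : 0 ≤ Δ)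
    {k : Fin n} (hk : ¬ S.CarryIn b k) (N : ℕ) :
    ∑ q ∈ Finset.range N, S.work b Δ k q ≤ WNC (τ k).C (τ k).T Δ := by
  have hC := (τ k).C_pos.le
  have hzero : ∀ q, S.release k q < b → S.work b Δ k q = 0 := by
    intro q hq
    refine work_eq_zero fun t ht _ hE => hk ⟨q, hq, fun hc => ?_⟩
    exact (hE.ready hS).2 (hc.mono ht)
  by_cases h : ∃ q, b ≤ S.release k q
  · classical
    -- The staircase starts at the first job released at or after `b`; all earlier ones are
    -- complete.
    have hlt : ∀ q < Nat.find h, S.release k q < b := fun q hq => not_le.1 (Nat.find_min h hq)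
    have h1 : ∑ q ∈ Finset.range N, S.work b Δ k q
        ≤ ∑ q ∈ Finset.range (Nat.find h + N), S.work b Δ k q :=
      Finset.sum_le_sum_of_subset_of_nonneg (Finset.range_subset_range.2 (by omega))
        fun q _ _ => S.work_nonneg b Δ k q
    rw [Finset.sum_range_add, Finset.sum_eq_zero (s := Finset.range (Nat.find h))
      fun q hq => hzero q (hlt q (Finset.mem_range.1 hq)), zero_add] at h1
    have h2 := sum_work_shift_le_staircase hτ hS (Δ := Δ) (r := 0)
      (by simpa using Nat.find_spec h) N
    rw [sub_zero] at h2
    exact h1.trans (h2.trans (staircase_le_WNC hC (τ k).T_pos N hΔ))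
  · push Not at h
    rw [Finset.sum_eq_zero fun q _ => hzero q (h q)]
    exact WNC_nonneg hC (τ k).T_pos hΔ

theorem sum_work_le_WCI (hm : 0 < m) (hτ : Feasible m τ) (hS : S.IsGFP τ) {b Δ : ℝ}
    {k : Fin n} (hk : S.CarryIn b k) (N : ℕ) :
    ∑ q ∈ Finset.range N, S.work b Δ k q ≤ WCI (τ k).C (τ k).T (wcrt m τ k) Δ := by
  obtain ⟨q₀, hq₀, hnc⟩ := hk
  set R := wcrt m τ k
  have hRT : R ≤ (τ k).T := hτ.wcrt_le_T k
  have hα : b < S.release k q₀ + R := by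
    by_contra! hle
    exact hnc ((hτ.completedBy_wcrt hS k q₀).mono hle)
  -- Since `R ≤ T`, an earlier job is complete by the next release, hence before `b`: there is only
  -- one carry-in job.
  have hzero : ∀ q < q₀, S.work b Δ k q = 0 := by
    intro q hq
    refine work_eq_zero fun t ht _ hE => ?_
    have h1 := lt_release_add_wcrt_of_executing hτ hS hE
    have h2 := hS.separation k q
    have h3 := release_mono hS k (Nat.succ_le_of_lt hq)
    simp only [Nat.succ_eq_add_one] at h3
    linarith
  have h0 : S.work b Δ k q₀ ≤ min (τ k).C (S.release k q₀ + R - b) := by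
    refine le_min (work_le_C hτ hS b Δ k q₀) ?_
    have := work_le_of_subset_Ico (S := S) (b := b) (Δ := Δ) (u := b) (k := k) (q := q₀)
      fun t h1 _ h3 => ⟨h1, lt_release_add_wcrt_of_executing hτ hS h3⟩
    rwa [max_eq_left (by linarith)] at this
  have h1 : ∑ q ∈ Finset.range N, S.work b Δ k q
      ≤ ∑ q ∈ Finset.range (q₀ + 1 + N), S.work b Δ k q :=
    Finset.sum_le_sum_of_subset_of_nonneg (Finset.range_subset_range.2 (by omega))
      fun q _ _ => S.work_nonneg b Δ k q
  rw [Finset.sum_range_add, Finset.sum_range_succ, Finset.sum_eq_zero (s := Finset.range q₀)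
    fun q hq => hzero q (Finset.mem_range.1 hq), zero_add] at h1
  have h2 := sum_work_shift_le_staircase hτ hS (b := b) (Δ := Δ)
    (r := S.release k q₀ + (τ k).T - b) (q₀ := q₀ + 1)
    (by linarith [hS.separation k q₀]) N
  have h3 := carryIn_add_staircase_le_WCI (Δ := Δ) (α := S.release k q₀ + R - b) (τ k).C_pos.le
    (τ k).T_pos (hτ.C_le_T hm k) hRT N
  rw [show Δ - (S.release k q₀ + R - b) + R - (τ k).T
    = Δ - (S.release k q₀ + (τ k).T - b) by ring] at h3
  linarith

/-! ### Times at which all cores execute jobs of higher priority -/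

/-- The times at which all cores execute jobs of tasks of higher priority than `i`. -/
def busy (S : Run n m) (i : Fin n) : Set ℝ :=
  {t : ℝ | ∀ c : Fin m, ∃ h q, h < i ∧ S.core c t = some (h, q)}

theorem interference_le_busy (S : Run n m) (i : Fin n) (a Δ : ℝ) :
    S.interference i a Δ ≤ volume.real (S.busy i ∩ Set.Ico a (a + Δ)) :=
  measureReal_mono (fun _ ht => ⟨ht.2.2, ht.1⟩)
    (volume_ne_top_of_subset_Ico fun _ ht => ht.2)

/-- The shift loses at most length `a - b` on the right and gains exactly that on the left; if it
exceeds `Δ`, the new window lies in `B` up to its left endpoint. -/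
theorem volume_inter_Ico_le_shift {B : Set ℝ} {a b Δ : ℝ} (hba : b ≤ a) (hΔ : 0 ≤ Δ)
    (hB : Set.Ioo b a ⊆ B) :
    volume.real (B ∩ Set.Ico a (a + Δ)) ≤ volume.real (B ∩ Set.Ico b (b + Δ)) := by
  have hfin : ∀ x y : ℝ, volume (B ∩ Set.Ico x y) ≠ ⊤ := fun x y =>
    volume_ne_top_of_subset_Ico fun _ ht => ht.2
  rcases le_total a (b + Δ) with h | h
  · have h1 : volume.real (B ∩ Set.Ico a (a + Δ))
        ≤ volume.real (B ∩ Set.Ico a (b + Δ)) + (a - b) := by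
      have hsub : B ∩ Set.Ico a (a + Δ) ⊆ (B ∩ Set.Ico a (b + Δ)) ∪ Set.Ico (b + Δ) (a + Δ) := by
        intro t ht
        rcases lt_or_ge t (b + Δ) with h' | h'
        · exact Or.inl ⟨ht.1, ht.2.1, h'⟩
        · exact Or.inr ⟨h', ht.2.2⟩
      refine (measureReal_mono hsub (measure_union_lt_top (hfin _ _).lt_top
        measure_Ico_lt_top).ne).trans ((measureReal_union_le _ _).trans ?_)
      rw [Real.volume_real_Ico_of_le (by linarith), add_sub_add_right_eq_sub]
    have h2 : volume.real (B ∩ Set.Ico a (b + Δ)) + (a - b)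
        ≤ volume.real (B ∩ Set.Ico b (b + Δ)) := by
      rw [← Real.volume_real_Ioo_of_le hba, ← measureReal_union _ measurableSet_Ioo (hfin _ _)
        measure_Ioo_lt_top.ne]
      · refine measureReal_mono ?_ (hfin _ _)
        rintro t (ht | ht)
        · exact ⟨ht.1, hba.trans ht.2.1, ht.2.2⟩
        · exact ⟨hB ht, ht.1.le, ht.2.trans_le h⟩
      · exact Set.disjoint_left.2 fun t ht ht' => ht'.2.not_ge ht.2.1
    exact h1.trans h2
  · calc volume.real (B ∩ Set.Ico a (a + Δ)) ≤ volume.real (Set.Ico a (a + Δ)) :=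
          measureReal_mono Set.inter_subset_right measure_Ico_lt_top.ne
      _ = volume.real (Set.Ioo b (b + Δ)) := by
          rw [Real.volume_real_Ico_of_le (by linarith), Real.volume_real_Ioo_of_le (by linarith)]
          ring
      _ ≤ volume.real (B ∩ Set.Ico b (b + Δ)) := by
          refine measureReal_mono (fun t ht => ?_) (hfin _ _)
          exact ⟨hB ⟨ht.1, ht.2.trans_le h⟩, ht.1.le, ht.2⟩

/-- Nothing executes before the earliest release of any task. -/
theorem exists_le_notMem_busy (hm : 0 < m) (hS : S.IsGFP τ) (i : Fin n) (a : ℝ) :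
    ∃ s ≤ a, s ∉ S.busy i := by
  obtain ⟨x, hx⟩ := (Set.finite_range fun k => S.release k 0).bddBelow
  refine ⟨min a x - 1, by linarith [min_le_left a x], fun hs => ?_⟩
  obtain ⟨h, q, _, hc⟩ := hs ⟨0, hm⟩
  have h1 := (hS.ready_of_core _ _ _ _ hc).1
  have h2 := release_mono hS h (Nat.zero_le q)
  have h3 := hx (Set.mem_range_self h)
  have h4 := min_le_right a x
  linarith

theorem executing_of_ready_of_notMem_busy (hS : S.IsGFP τ) {i j : Fin n} (hj : j < i) {q : ℕ}
    {s : ℝ} (hs : s ∉ S.busy i) (hR : S.Ready j q s) : S.Executing j q s := by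
  by_contra hE
  refine hs fun c => ?_
  obtain ⟨k, p, hc, hk⟩ := hS.priority j q s hR hE c
  refine ⟨k, p, ?_, hc⟩
  rcases hk with hk | hk
  · exact hk.trans hj
  · exact hk.1 ▸ hj

theorem card_ready_lt (hS : S.IsGFP τ) {i : Fin n} {s : ℝ} (hs : s ∉ S.busy i) {A : Finset (Fin n)}
    (hA : ∀ j ∈ A, j < i ∧ ∃ q, S.Ready j q s) : A.card < m := by
  classical
  have hex : ∀ j ∈ A, ∃ c, ∃ q, S.core c s = some (j, q) := by
    intro j hj
    obtain ⟨hji, q, hq⟩ := hA j hj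
    obtain ⟨c, hc⟩ := executing_of_ready_of_notMem_busy hS hji hs hq
    exact ⟨c, q, hc⟩
  -- The core `c₀` is missed by the injection from ready tasks to cores; hence the strict
  -- inequality.
  obtain ⟨c₀, hc₀⟩ : ∃ c : Fin m, ∀ h q, h < i → S.core c s ≠ some (h, q) := by
    by_contra! h
    exact hs h
  have : Nonempty (Fin m) := ⟨c₀⟩
  choose! f hf using hex
  have hlt : (A.image f).card < (Finset.univ : Finset (Fin m)).card := by
    refine Finset.card_lt_card (Finset.ssubset_univ_iff.2 fun h => ?_)
    obtain ⟨j, hj, hjc⟩ := Finset.mem_image.1 (h ▸ Finset.mem_univ c₀)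
    obtain ⟨q, hq⟩ := hf j hj
    exact hc₀ j q (hA j hj).1 (hjc ▸ hq)
  rw [Finset.card_image_of_injOn] at hlt
  · simpa using hlt
  · intro j hj k hk hjk
    obtain ⟨q, hq⟩ := hf j hj
    obtain ⟨p, hp⟩ := hf k hk
    rw [hjk, hp] at hq
    exact (Prod.mk.inj (Option.some.inj hq)).1.symm

theorem card_carryIn_lt (hS : S.IsGFP τ) {i : Fin n} {b : ℝ}
    (hb : ∀ x < b, ∃ s, x < s ∧ s ≤ b ∧ s ∉ S.busy i) {A : Finset (Fin n)}
    (hA : ∀ j ∈ A, j < i ∧ S.CarryIn b j) : A.card < m := by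
  have hcarry : ∀ j ∈ A, ∃ q, S.release j q < b ∧ ¬ S.CompletedBy j q b := fun j hj => (hA j hj).2
  choose! q hq using hcarry
  -- The supremum `b` may itself be busy. The finitely many carry-in jobs are released strictly
  -- before `b`, so all are ready at some non-busy `s` near `b`.
  obtain ⟨x, hxb, hx⟩ : ∃ x < b, ∀ j ∈ A, S.release j (q j) ≤ x := by
    rcases A.eq_empty_or_nonempty with rfl | hne
    · exact ⟨b - 1, by linarith, by simp⟩
    · refine ⟨A.sup' hne fun j => S.release j (q j), ?_, fun j hj => ?_⟩
      · exact (Finset.sup'_lt_iff hne).2 fun j hj => (hq j hj).1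
      · exact Finset.le_sup' (fun j => S.release j (q j)) hj
  obtain ⟨s, hxs, hsb, hs⟩ := hb x hxb
  refine card_ready_lt hS hs fun j hj => ⟨(hA j hj).1, q j, (hx j hj).trans hxs.le, fun hc => ?_⟩
  exact (hq j hj).2 (hc.mono hsb)

theorem exists_forall_le_release (hS : S.IsGFP τ) (x : ℝ) :
    ∃ N : ℕ, ∀ k q, N ≤ q → x ≤ S.release k q := by
  have : ∀ k, ∃ N : ℕ, x ≤ S.release k N := by
    intro k
    obtain ⟨N, hN⟩ := exists_nat_gt ((x - S.release k 0) / (τ k).T)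
    rw [div_lt_iff₀ (τ k).T_pos] at hN
    have := release_add_mul_le hS k 0 N
    rw [zero_add] at this
    exact ⟨N, by linarith⟩
  choose f hf using this
  refine ⟨Finset.univ.sup f, fun k q hq => (hf k).trans (release_mono hS k ?_)⟩
  exact (Finset.le_sup (Finset.mem_univ k)).trans hq

theorem sum_core_eq_work (hS : S.IsGFP τ) (b Δ : ℝ) (k : Fin n) (q : ℕ) :
    ∑ c, volume.real {t : ℝ | t ∈ Set.Ico b (b + Δ) ∧ S.core c t = some (k, q)}
      = S.work b Δ k q := by
  have hU : {t : ℝ | t ∈ Set.Ico b (b + Δ) ∧ S.Executing k q t}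
      = ⋃ c, {t : ℝ | t ∈ Set.Ico b (b + Δ) ∧ S.core c t = some (k, q)} := by
    ext t
    simp [Executing]
  rw [work, hU, measureReal_iUnion_fintype _ _
    fun c => volume_ne_top_of_subset_Ico fun t ht => ht.1]
  · intro c c' hcc
    exact Set.disjoint_left.2 fun t ht ht' => hcc (hS.sequential c c' t _ ht.2 ht'.2)
  · exact fun c => measurableSet_Ico.inter (hS.measurable c _)

/-- At busy times each of the `m` cores serves a higher-priority job; summing over cores and
regrouping by job gives the work. `N` cuts off jobs released after the window. -/
theorem exists_mul_busy_le_sum_work (hS : S.IsGFP τ) (i : Fin n) (b Δ : ℝ) :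
    ∃ N : ℕ, m * volume.real (S.busy i ∩ Set.Ico b (b + Δ))
      ≤ ∑ k ∈ Finset.Iio i, ∑ q ∈ Finset.range N, S.work b Δ k q := by
  obtain ⟨N, hN⟩ := exists_forall_le_release hS (b + Δ)
  refine ⟨N, ?_⟩
  have hc : ∀ c : Fin m, volume.real (S.busy i ∩ Set.Ico b (b + Δ))
      ≤ ∑ x ∈ Finset.Iio i ×ˢ Finset.range N,
        volume.real {t : ℝ | t ∈ Set.Ico b (b + Δ) ∧ S.core c t = some (x.1, x.2)} := by
    intro c
    refine (measureReal_mono (s₂ := ⋃ x ∈ Finset.Iio i ×ˢ Finset.range N,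
      {t : ℝ | t ∈ Set.Ico b (b + Δ) ∧ S.core c t = some (x.1, x.2)}) ?_ ?_).trans
      (measureReal_biUnion_finset_le _ _)
    · rintro t ⟨ht, htW⟩
      obtain ⟨k, q, hk, hcq⟩ := ht c
      have hq : q < N := by
        by_contra! hle
        have h1 := hN k q hle
        have h2 := (hS.ready_of_core _ _ _ _ hcq).1
        exact htW.2.not_ge (h1.trans h2)
      simp only [Set.mem_iUnion]
      exact ⟨(k, q), by simp [hk, hq], htW, hcq⟩
    · refine volume_ne_top_of_subset_Ico (x := b) (y := b + Δ) fun t ht => ?_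
      simp only [Set.mem_iUnion] at ht
      obtain ⟨x, _, htW, _⟩ := ht
      exact htW
  calc m * volume.real (S.busy i ∩ Set.Ico b (b + Δ))
      = ∑ _c : Fin m, volume.real (S.busy i ∩ Set.Ico b (b + Δ)) := by simp
    _ ≤ _ := Finset.sum_le_sum fun c _ => hc c
    _ = _ := by
      rw [Finset.sum_comm, Finset.sum_product]
      exact Finset.sum_congr rfl fun k _ => Finset.sum_congr rfl fun q _ =>
        sum_core_eq_work hS b Δ k q

/-! ### The interference bound -/

theorem mul_interference_le (hm : 0 < m) (hτ : Feasible m τ) (hS : S.IsGFP τ) (i : Fin n) (a : ℝ)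
    {Δ : ℝ} (hΔ : 0 ≤ Δ) :
    m * S.interference i a Δ ≤ carryInTerm m τ i Δ + noCarryInTerm τ i Δ := by
  classical
  set Z := {s : ℝ | s ≤ a ∧ s ∉ S.busy i} with hZ
  have hne : Z.Nonempty := exists_le_notMem_busy hm hS i a
  have hbdd : BddAbove Z := ⟨a, fun s hs => hs.1⟩
  set b := sSup Z with hbdef
  have hba : b ≤ a := csSup_le hne fun s hs => hs.1
  have hB : Set.Ioo b a ⊆ S.busy i := by
    intro t ht
    by_contra h
    exact ht.1.not_ge (le_csSup hbdd ⟨ht.2.le, h⟩)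
  have hclose : ∀ x < b, ∃ s, x < s ∧ s ≤ b ∧ s ∉ S.busy i := by
    intro x hx
    obtain ⟨s, hs, hxs⟩ := exists_lt_of_lt_csSup hne hx
    exact ⟨s, hxs, le_csSup hbdd hs, hs.2⟩
  set A := (Finset.Iio i).filter (S.CarryIn b) with hA
  have hcard : A.card ≤ m - 1 := by
    have : A.card < m := card_carryIn_lt hS hclose fun j hj => by simpa [hA] using hj
    omega
  obtain ⟨N, hN⟩ := exists_mul_busy_le_sum_work hS i b Δ
  have hdiff : ∑ k ∈ A, Wdiff (τ k).C (τ k).T (wcrt m τ k) Δ ≤ carryInTerm m τ i Δ :=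
    sum_le_sum_nthGreatest (Finset.filter_subset _ _) (fun j _ =>
      Wdiff_nonneg (τ j).C_pos.le (τ j).T_pos (hτ.C_le_T hm j) (hτ.C_le_wcrt hm j)
        (hτ.wcrt_le_T j) hΔ) hcard
  calc m * S.interference i a Δ
      ≤ m * volume.real (S.busy i ∩ Set.Ico b (b + Δ)) := by
        gcongr
        exact (S.interference_le_busy i a Δ).trans (volume_inter_Ico_le_shift hba hΔ hB)
    _ ≤ _ := hN
    _ ≤ ∑ k ∈ Finset.Iio i, ((if S.CarryIn b k then Wdiff (τ k).C (τ k).T (wcrt m τ k) Δ else 0)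
          + WNC (τ k).C (τ k).T Δ) := by
        refine Finset.sum_le_sum fun k _ => ?_
        split_ifs with hk
        · rw [Wdiff, sub_add_cancel]
          exact sum_work_le_WCI hm hτ hS hk N
        · rw [zero_add]
          exact sum_work_le_WNC hτ hS hΔ hk N
    _ = ∑ k ∈ A, Wdiff (τ k).C (τ k).T (wcrt m τ k) Δ + noCarryInTerm τ i Δ := by
        rw [Finset.sum_add_distrib, ← Finset.sum_filter, noCarryInTerm]
    _ ≤ _ := by gcongr

end Run

theorem noCarryInTerm_nonneg (τ : Fin n → LLTask) (i : Fin n) {Δ : ℝ} (hΔ : 0 ≤ Δ) :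
    0 ≤ noCarryInTerm τ i Δ :=
  Finset.sum_nonneg fun k _ => WNC_nonneg (τ k).C_pos.le (τ k).T_pos hΔ

end GlobalFixedPriority

theorem mainTheorem3 {n m : ℕ} (hm : 0 < m) (τ : Fin n → GlobalFixedPriority.LLTask)
    (hτ : GlobalFixedPriority.Feasible m τ)
    (S : GlobalFixedPriority.Run n m) (hS : S.IsGFP τ)
    (i : Fin n) (a Δ : ℝ) (hΔ : 0 ≤ Δ) :
    S.interference i a Δ
        ≤ 1 / (m : ℝ) * GlobalFixedPriority.carryInTerm m τ i Δ
          + GlobalFixedPriority.noCarryInTerm τ i Δ ∧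
      S.interference i a Δ
        ≤ 1 / (m : ℝ) * (GlobalFixedPriority.carryInTerm m τ i Δ
          + GlobalFixedPriority.noCarryInTerm τ i Δ) := by
  have hm' : (0 : ℝ) < m := by exact_mod_cast hm
  have hmain := GlobalFixedPriority.Run.mul_interference_le hm hτ hS i a hΔ
  have hNC := GlobalFixedPriority.noCarryInTerm_nonneg τ i hΔ
  have hbound : S.interference i a Δ ≤ 1 / (m : ℝ) * (GlobalFixedPriority.carryInTerm m τ i Δ
      + GlobalFixedPriority.noCarryInTerm τ i Δ) := by
    rwa [one_div, ← div_eq_inv_mul, le_div_iff₀' hm']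
  refine ⟨hbound.trans ?_, hbound⟩
  rw [mul_add]
  gcongr
  -- The first bound is weaker only by the factor `1 / m ≤ 1` on the nonnegative no-carry-in sum.
  refine mul_le_of_le_one_left hNC ?_
  rw [div_le_one hm']
  exact_mod_cast hm
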